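/- Let $\delta<1/3$ and $\eta_0<1$ be real numbers. There is a constant $C=C(\delta,\eta_0)>0$, depending only on $\delta$ and $\eta_0$ (so only on $\delta$ if one fixes, say, $\eta_0=1/2$), such that the following holds for all integers $k\ge 2$, $m\ge 0$, $n\ge 1$ with $k\mid n$, all $0<\eta\le\eta_0$ and all scalars $\alpha\in\mathbb{R}$. Let $F$ be the $n\times n$ unitary discrete Fourier transform matrix, $F_{ab}=n^{-1/2}e^{-2\pi i ab/n}$ for $a,b\in\mathbb{Z}/n\mathbb{Z}$, and let $\Phi$ be the random $m\times n$ matrix whose $m$ rows are drawn independently and uniformly, with replacement, from the rows of $F$. If, with probability at least $1-\eta$, the matrix $A=\alpha\Phi$ satisfies the $(k,\delta)$-restricted isometry property, i.e. $$(1-\delta)\|x\|_2^2\le\|Ax\|_2^2\le(1+\delta)\|x\|_2^2\qquad\text{for every }x\in\mathbb{C}^n\text{ with at most }k\text{ nonzero entries},$$ then $$m\ \ge\ C\,k\left(\log(en)+\log\frac{1}{2\eta}\right).$$ (The scalar $\alpha$ covers every normalization of the matrix, e.g. $\alpha=1$ or the customary $\alpha=\sqrt{n/m}$.) -/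

import Mathlib

open MeasureTheory ProbabilityTheory

noncomputable section

/-- The number of nonzero entries of a vector, `‖x‖₀`. -/
def zeroNorm {ι : Type*} [Fintype ι] (x : EuclideanSpace ℂ ι) : ℕ :=
  {i | x i ≠ 0}.ncard

/-- The `(k, δ)`-restricted isometry property of a complex matrix: `Φ` preserves the squared
Euclidean norm of every `k`-sparse vector up to the factors `1 - δ` and `1 + δ`. -/
def RestrictedIsometry {ι κ : Type*} [Fintype ι] [Fintype κ] [DecidableEq κ]
    (k : ℕ) (δ : ℝ) (Φ : Matrix ι κ ℂ) : Prop :=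
  ∀ x : EuclideanSpace ℂ κ, zeroNorm x ≤ k →
    (1 - δ) * ‖x‖ ^ 2 ≤ ‖Matrix.toEuclideanLin Φ x‖ ^ 2 ∧
      ‖Matrix.toEuclideanLin Φ x‖ ^ 2 ≤ (1 + δ) * ‖x‖ ^ 2

/-- The unitary `n × n` discrete Fourier transform matrix, with entries
`n ^ (-1/2) * exp (-2 π i a b / n)` for `a b : ℤ/n`. -/
def dftMatrix (n : ℕ) [NeZero n] : Matrix (ZMod n) (ZMod n) ℂ :=
  Matrix.of fun a b => (1 / (Real.sqrt n : ℂ)) * ZMod.stdAddChar (-(a * b))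

/-- The `m × n` matrix whose `i`-th row is the `r i`-th row of the DFT matrix
(rows may be repeated). -/
def partialDFT {m n : ℕ} [NeZero n] (r : Fin m → ZMod n) : Matrix (Fin m) (ZMod n) ℂ :=
  (dftMatrix n).submatrix r id

end

/-! Three lower bounds on `m` are combined: `k ≤ m`, `k log n ≲ m` and `k log (1/η) ≲ m`. A
character of frequency `c` restricted to the subgroup of order `k` is `k`-sparse and is killed by
every row outside the class of `c` mod `k`. Restricted isometry therefore forces the sampled rows to
hit all `k` classes (`RestrictedIsometry.exists_row`), a coupon-collector problem: already `k ≤ m`;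
missing one given class has probability `(1 - 1/k)^m`, hence at most `η`; and the second moment
method gives `k log k ≲ m`.

If `n < k²`, then `log n ≤ 2 log k` and this suffices. If `k² ≤ n`, a packing argument works for any
matrix: a Reed–Solomon family of sparse indicators has well-separated images in a ball of real
dimension `2m`. -/

/-! ### Packing bound for arbitrary matrices -/

/-- The vector with entries `1` on `S` and `0` elsewhere. -/
noncomputable def indicatorVec {ι : Type*} [DecidableEq ι] (S : Finset ι) : EuclideanSpace ℂ ι :=
  WithLp.toLp 2 fun i => if i ∈ S then 1 else 0

theorem zeroNorm_le_card {ι : Type*} [Fintype ι] (x : EuclideanSpace ℂ ι) (S : Finset ι)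
    (h : ∀ i, i ∉ S → x i = 0) : zeroNorm x ≤ S.card := by
  rw [zeroNorm, ← Set.ncard_coe_finset]
  refine Set.ncard_le_ncard (fun i hi => ?_) S.finite_toSet
  by_contra hS
  exact hi (h i hS)

theorem norm_sq_indicatorVec {ι : Type*} [Fintype ι] [DecidableEq ι] (S : Finset ι) :
    ‖indicatorVec S‖ ^ 2 = S.card := by
  have h (i : ι) : ‖indicatorVec S i‖ ^ 2 = if i ∈ S then (1 : ℝ) else 0 := by
    by_cases hS : i ∈ S <;> simp [indicatorVec, hS]
  simp [EuclideanSpace.norm_sq_eq, h]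

theorem norm_sq_indicatorVec_sub {ι : Type*} [Fintype ι] [DecidableEq ι] (S T : Finset ι) :
    ‖indicatorVec S - indicatorVec T‖ ^ 2 = S.card + T.card - 2 * (S ∩ T).card := by
  have h (U : Finset ι) : (U.card : ℝ) = ∑ i, if i ∈ U then (1 : ℝ) else 0 := by simp
  rw [EuclideanSpace.norm_sq_eq, h S, h T, h (S ∩ T), Finset.mul_sum, ← Finset.sum_add_distrib,
    ← Finset.sum_sub_distrib]
  refine Finset.sum_congr rfl fun i _ => ?_
  by_cases hS : i ∈ S <;> by_cases hT : i ∈ T <;> simp [indicatorVec, hS, hT]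
  norm_num

/-- A matrix with the restricted isometry property separates a family of sparse sets with small
pairwise intersections, so that the size of the family is at most exponential in the number of
rows. -/
theorem RestrictedIsometry.card_le {m s k : ℕ} {ι β : Type*} [Fintype ι] [DecidableEq ι]
    [Fintype β] {δ : ℝ} (hδ : δ < 1 / 3) {A : Matrix (Fin m) ι ℂ} (hA : RestrictedIsometry k δ A)
    (hs : 0 < s) (hsk : 2 * s ≤ k) (f : β → Finset ι) (hf : ∀ b, (f b).card = s)
    (hff : ∀ b b', b ≠ b' → 2 * (f b ∩ f b').card ≤ s) :
    Fintype.card β ≤ 5 ^ (2 * m) := by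
  classical
  have hs' : (0 : ℝ) < s := by exact_mod_cast hs
  -- Scaled so that the lower bound `(1 - δ) s ≥ 2s/3` on squared distances becomes exactly `1`;
  -- squared norms are then at most `(4/3)(3/2) = 2 ≤ 4`.
  set t : ℝ := (Real.sqrt (2 * s / 3))⁻¹ with ht
  have htp : 0 < t := by positivity
  have ht2 : t ^ 2 * s = 3 / 2 := by
    rw [ht, inv_pow, Real.sq_sqrt (by positivity)]
    field_simp
  let y : β → EuclideanSpace ℂ (Fin m) := fun b =>
    t • Matrix.toEuclideanLin A (indicatorVec (f b))
  have hy (b) : ‖y b‖ ≤ 2 := by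
    have h := (hA (indicatorVec (f b)) ((zeroNorm_le_card _ (f b)
      (by intro i hi; simp [indicatorVec, hi])).trans (by rw [hf]; omega))).2
    rw [norm_sq_indicatorVec, hf] at h
    refine abs_le_of_sq_le_sq' ?_ zero_le_two |>.2
    simp only [y]
    rw [norm_smul, mul_pow, Real.norm_of_nonneg htp.le]
    nlinarith [mul_le_mul_of_nonneg_left h (sq_nonneg t)]
  have hyy (b b') (hb : b ≠ b') : 1 ≤ ‖y b - y b'‖ := by
    have h := (hA (indicatorVec (f b) - indicatorVec (f b')) ((zeroNorm_le_card _ (f b ∪ f b')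
      (by
        intro i hi
        rw [Finset.mem_union, not_or] at hi
        simp [indicatorVec, hi.1, hi.2])).trans
      ((Finset.card_union_le _ _).trans (by rw [hf, hf]; omega)))).1
    have h2 : (2 * (f b ∩ f b').card : ℝ) ≤ s := by exact_mod_cast hff b b' hb
    rw [norm_sq_indicatorVec_sub, hf, hf, map_sub] at h
    have h3 : ‖y b - y b'‖ ^ 2 = t ^ 2 * ‖Matrix.toEuclideanLin A (indicatorVec (f b)) -
        Matrix.toEuclideanLin A (indicatorVec (f b'))‖ ^ 2 := by
      simp only [y]
      rw [← smul_sub, norm_smul, mul_pow, Real.norm_of_nonneg htp.le]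
    have h4 : 2 / 3 * (s : ℝ) ≤ (1 - δ) * (s + s - 2 * (f b ∩ f b').card) := by
      apply mul_le_mul <;> linarith
    have h5 := mul_le_mul_of_nonneg_left (h4.trans h) (sq_nonneg t)
    rw [← h3] at h5
    refine (one_le_sq_iff₀ (norm_nonneg _)).1 ?_
    linarith
  have hinj : Function.Injective y := by
    intro b b' h
    by_contra hb
    have := hyy b b' hb
    rw [h, sub_self, norm_zero] at this
    linarith
  have := Besicovitch.card_le_of_separated (Finset.univ.image y)
    (by simpa using hy)
    (by
      simp only [Finset.mem_image, Finset.mem_univ, true_and]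
      rintro _ ⟨b, rfl⟩ _ ⟨b', rfl⟩ h
      exact hyy b b' fun hb => h (by rw [hb]))
  rwa [Finset.card_image_of_injective _ hinj, Finset.card_univ, finrank_real_of_complex,
    finrank_euclideanSpace_fin] at this

open Polynomial in
/-- Reed–Solomon families of sets: graphs of polynomials of degree less than `d`. -/
theorem exists_finset_family_small_inter {ι : Type*} [Fintype ι] [DecidableEq ι] {p s d : ℕ}
    [Fact p.Prime] (hsp : s ≤ p) (hcard : s * p ≤ Fintype.card ι) :
    ∃ f : (Fin d → ZMod p) → Finset ι, (∀ b, (f b).card = s) ∧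
      ∀ b b', b ≠ b' → (f b ∩ f b').card < d := by
  obtain ⟨e⟩ : Nonempty (Fin s × ZMod p ↪ ι) :=
    Function.Embedding.nonempty_of_card_le (by simpa [ZMod.card] using hcard)
  let P : (Fin d → ZMod p) → (ZMod p)[X] := fun b => ((degreeLTEquiv (ZMod p) d).symm b : (ZMod p)[X])
  let g : (Fin d → ZMod p) → Fin s → ι := fun b i => e (i, (P b).eval ((i : ℕ) : ZMod p))
  have hg (b) : Function.Injective (g b) := fun i j h => (Prod.ext_iff.1 (e.injective h)).1
  have hcast : Function.Injective (fun i : Fin s => ((i : ℕ) : ZMod p)) := by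
    intro i j h
    have := (ZMod.natCast_eq_natCast_iff' _ _ _).1 h
    rw [Nat.mod_eq_of_lt (i.2.trans_le hsp), Nat.mod_eq_of_lt (j.2.trans_le hsp)] at this
    exact Fin.ext this
  refine ⟨fun b => Finset.univ.image (g b), fun b => ?_, fun b b' hb => ?_⟩
  · rw [Finset.card_image_of_injective _ (hg b), Finset.card_univ, Fintype.card_fin]
  have hP : P b - P b' ≠ 0 := by
    intro h
    apply hb
    apply (degreeLTEquiv (ZMod p) d).symm.injective
    exact Subtype.ext (sub_eq_zero.1 h)
  have hdeg : (P b - P b').natDegree < d := by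
    rw [natDegree_lt_iff_degree_lt hP]
    exact mem_degreeLT.1 (Submodule.sub_mem _ (Subtype.mem _) (Subtype.mem _))
  -- A common point of two graphs lies over a root of the difference polynomial, which has fewer
  -- than `d` roots.
  have hsub : Finset.univ.image (g b) ∩ Finset.univ.image (g b') ⊆
      ((Finset.univ : Finset (Fin s)).filter
        fun i : Fin s => (P b - P b').IsRoot ((i : ℕ) : ZMod p)).image (g b) := by
    intro x hx
    simp only [Finset.mem_inter, Finset.mem_image, Finset.mem_univ, true_and] at hx
    obtain ⟨⟨i, rfl⟩, j, hj⟩ := hx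
    have h := Prod.ext_iff.1 (e.injective hj)
    obtain rfl : j = i := h.1
    refine Finset.mem_image_of_mem _ (Finset.mem_filter.2 ⟨Finset.mem_univ _, ?_⟩)
    rw [IsRoot.def, eval_sub, sub_eq_zero]
    exact h.2.symm
  refine ((Finset.card_le_card hsub).trans Finset.card_image_le).trans_lt (lt_of_le_of_lt ?_ hdeg)
  rw [← Finset.card_image_of_injective (Finset.univ.filter
    fun i : Fin s => (P b - P b').IsRoot ((i : ℕ) : ZMod p)) hcast]
  refine le_trans (Finset.card_le_card ?_) ((Multiset.toFinset_card_le _).trans (card_roots' _))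
  intro x hx
  obtain ⟨i, hi, rfl⟩ := Finset.mem_image.1 hx
  exact Multiset.mem_toFinset.2 ((mem_roots hP).2 (Finset.mem_filter.1 hi).2)

/-- If `k² ≤ n`, a matrix with `n` columns and the restricted isometry property of order `k` has at
least of the order of `k log n` rows. -/
theorem RestrictedIsometry.mul_log_le_of_sq_le {m n k : ℕ} {ι : Type*} [Fintype ι] [DecidableEq ι]
    (hι : Fintype.card ι = n) {δ : ℝ} (hδ : δ < 1 / 3) {A : Matrix (Fin m) ι ℂ}
    (hA : RestrictedIsometry k δ A) (hk : 2 ≤ k) (hkn : k ^ 2 ≤ n) :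
    k * Real.log n ≤ 48 * m := by
  -- With `s = ⌊k/2⌋`, differences of two indicators are still `k`-sparse; with `d = ⌈s/2⌉`, an
  -- intersection smaller than `d` has at most `s/2` elements.
  obtain ⟨s, hs⟩ : ∃ s, s = k / 2 := ⟨_, rfl⟩
  obtain ⟨d, hd⟩ : ∃ d, d = (s + 1) / 2 := ⟨_, rfl⟩
  have hs1 : 1 ≤ s := by omega
  have hks : 2 * s ≤ k := by omega
  obtain ⟨q, hq⟩ : ∃ q, q = n / (2 * s) := ⟨_, rfl⟩
  have hkq : k ≤ q := by
    rw [hq, Nat.le_div_iff_mul_le (by omega)]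
    nlinarith
  -- Bertrand's postulate: `p ≤ 2q` makes the `s × p` grid fit into `n` columns, while `q < p` gives
  -- `n < p k ≤ p²`, so `log p` is comparable to `log n`.
  obtain ⟨p, hp, hqp, hpq⟩ := Nat.exists_prime_lt_and_le_two_mul q (by omega)
  have : Fact p.Prime := ⟨hp⟩
  have hqn : q * (2 * s) ≤ n := by rw [hq]; exact Nat.div_mul_le_self _ _
  have hnp : n < p * k := by
    have : n < p * (2 * s) := (Nat.div_lt_iff_lt_mul (by omega)).1 (hq ▸ hqp)
    exact this.trans_le (Nat.mul_le_mul_left _ hks)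
  obtain ⟨f, hf, hff⟩ := exists_finset_family_small_inter (ι := ι) (p := p) (s := s) (d := d)
    (by omega) (by rw [hι]; nlinarith)
  have hcard := hA.card_le hδ hs1 hks f hf fun b b' hb => by
    have := hff b b' hb
    omega
  rw [Fintype.card_fun, ZMod.card, Fintype.card_fin] at hcard
  have hnp2 : n ≤ p ^ 2 := by nlinarith
  have hp0 : (0 : ℝ) < p := by exact_mod_cast hp.pos
  have hn0 : (0 : ℝ) < n := by
    have : 0 < n := by nlinarith
    exact_mod_cast this
  have h1 : (d : ℝ) * Real.log p ≤ (2 * m : ℕ) * Real.log 5 := by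
    rw [← Real.log_pow, ← Real.log_pow]
    exact Real.log_le_log (by positivity) (by exact_mod_cast hcard)
  have h2 : Real.log n ≤ 2 * Real.log p := by
    rw [← Nat.cast_two, ← Real.log_pow]
    exact Real.log_le_log hn0 (by exact_mod_cast hnp2)
  have h5 : Real.log 5 ≤ 2 := by
    rw [Real.log_le_iff_le_exp (by norm_num)]
    have := Real.exp_one_gt_d9
    rw [show (2 : ℝ) = 1 + 1 by norm_num, Real.exp_add]
    nlinarith
  have hdk : (k : ℝ) ≤ 6 * d := by
    have : k ≤ 6 * d := by omega
    exact_mod_cast this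
  have hlp : 0 ≤ Real.log p := Real.log_natCast_nonneg _
  push_cast at h1
  have hm : (0 : ℝ) ≤ m := Nat.cast_nonneg _
  calc (k : ℝ) * Real.log n ≤ (6 * d) * (2 * Real.log p) := by gcongr
    _ = 12 * (d * Real.log p) := by ring
    _ ≤ 12 * (2 * m * 2) := by gcongr 12 * ?_; exact h1.trans (by gcongr)
    _ = 48 * m := by ring

/-! ### Characters on the subgroup of order `k` -/

/-- The character `b ↦ exp (2πicb/n)` restricted to the multiples of `n / k`. -/
noncomputable def subgroupCharVec (n k : ℕ) [NeZero n] (c : ZMod n) : EuclideanSpace ℂ (ZMod n) :=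
  WithLp.toLp 2 fun b => if (k : ZMod n) * b = 0 then ZMod.stdAddChar (c * b) else 0

theorem card_mul_eq_zero {n k : ℕ} [NeZero n] (hkn : k ∣ n) :
    (Finset.univ.filter fun b : ZMod n => (k : ZMod n) * b = 0).card ≤ k := by
  obtain ⟨l, rfl⟩ := hkn
  have hk : 0 < k := Nat.pos_of_ne_zero fun h => NeZero.ne (k * l) (by simp [h])
  have hl : 0 < l := Nat.pos_of_ne_zero fun h => NeZero.ne (k * l) (by simp [h])
  have hsub : (Finset.univ.filter fun b : ZMod (k * l) => (k : ZMod (k * l)) * b = 0) ⊆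
      (Finset.range k).image fun j => ((j * l : ℕ) : ZMod (k * l)) := by
    intro b hb
    have hb : (k : ZMod (k * l)) * b = 0 := (Finset.mem_filter.1 hb).2
    rw [← ZMod.natCast_zmod_val b, ← Nat.cast_mul, ZMod.natCast_eq_zero_iff] at hb
    obtain ⟨j, hj⟩ := Nat.dvd_of_mul_dvd_mul_left hk hb
    refine Finset.mem_image.2 ⟨j, Finset.mem_range.2 ?_, ?_⟩
    · have := ZMod.val_lt b
      rw [hj, mul_comm k l] at this
      exact Nat.lt_of_mul_lt_mul_left this
    · rw [mul_comm j l, ← hj, ZMod.natCast_zmod_val]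
  exact (Finset.card_le_card hsub).trans (Finset.card_image_le.trans (Finset.card_range k).le)

/-- If `z` is not divisible by `k`, the character `b ↦ exp (2πizb/n)` is nontrivial on the multiples
of `n / k`, so it sums to zero over them. -/
theorem sum_stdAddChar_subgroup_eq_zero {n k : ℕ} [NeZero n] (hkn : k ∣ n) {z : ZMod n}
    (hz : ZMod.castHom hkn (ZMod k) z ≠ 0) :
    ∑ b : ZMod n, (if (k : ZMod n) * b = 0 then ZMod.stdAddChar (z * b) else (0 : ℂ)) = 0 := by
  obtain ⟨l, hl⟩ := hkn
  have hl0 : 0 < l := Nat.pos_of_ne_zero fun h => NeZero.ne n (by simp [hl, h])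
  have hkl : (k : ZMod n) * l = 0 := by
    rw [← Nat.cast_mul, ← hl, ZMod.natCast_self]
  have hne : ZMod.stdAddChar (z * (l : ZMod n)) ≠ 1 := by
    rw [← (ZMod.stdAddChar (N := n)).map_zero_eq_one, ZMod.injective_stdAddChar.ne_iff]
    intro h
    apply hz
    rw [← ZMod.natCast_zmod_val z, ← Nat.cast_mul, ZMod.natCast_eq_zero_iff] at h
    have h' : k ∣ z.val := Nat.dvd_of_mul_dvd_mul_right hl0 (hl ▸ h)
    rw [← ZMod.natCast_zmod_val z, map_natCast]
    exact (ZMod.natCast_eq_zero_iff _ _).2 h'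
  set S := ∑ b : ZMod n, (if (k : ZMod n) * b = 0 then ZMod.stdAddChar (z * b) else (0 : ℂ)) with hS
  -- Translation by `l = n/k` permutes the subgroup and multiplies the sum by a factor different
  -- from `1`.
  have h : S = ZMod.stdAddChar (z * (l : ZMod n)) * S := by
    conv_lhs => rw [hS, ← Equiv.sum_comp (Equiv.addLeft (l : ZMod n))]
    rw [hS, Finset.mul_sum]
    refine Finset.sum_congr rfl fun b _ => ?_
    simp only [Equiv.coe_addLeft, mul_add, hkl, zero_add, AddChar.map_add_eq_mul, mul_ite, mul_zero]
  by_contra h0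
  exact hne (mul_right_cancel₀ h0 (by rw [one_mul]; exact h.symm))

/-- A row submatrix of the DFT matrix with the restricted isometry property of order `k ∣ n` has a
row in every residue class modulo `k`. -/
theorem RestrictedIsometry.exists_row {m n k : ℕ} [NeZero n] (hkn : k ∣ n) {δ : ℝ} (hδ : δ < 1)
    {α : ℂ} {r : Fin m → ZMod n} (hA : RestrictedIsometry k δ (α • partialDFT r)) (c : ZMod k) :
    ∃ i, ZMod.castHom hkn (ZMod k) (r i) = c := by
  by_contra! hc
  obtain ⟨c, rfl⟩ := ZMod.castHom_surjective hkn c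
  have hsp : zeroNorm (subgroupCharVec n k c) ≤ k :=
    (zeroNorm_le_card _ (Finset.univ.filter fun b : ZMod n => (k : ZMod n) * b = 0)
      (by intro b hb; simp_all [subgroupCharVec])).trans (card_mul_eq_zero hkn)
  have hzero : Matrix.toEuclideanLin (α • partialDFT r) (subgroupCharVec n k c) = 0 := by
    ext i
    have hz : ZMod.castHom hkn (ZMod k) (c - r i) ≠ 0 := by
      rw [map_sub, sub_ne_zero]
      exact (hc i).symm
    have h := sum_stdAddChar_subgroup_eq_zero hkn hz
    simp only [Matrix.toLpLin_apply, Matrix.smul_mulVec, Matrix.mulVec,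
      dotProduct, partialDFT, dftMatrix, subgroupCharVec, Pi.smul_apply, Matrix.submatrix_apply,
      Matrix.of_apply, id, PiLp.zero_apply, smul_eq_mul]
    have h' : ∀ b : ZMod n, 1 / (Real.sqrt n : ℂ) * ZMod.stdAddChar (-(r i * b)) *
        (if (k : ZMod n) * b = 0 then ZMod.stdAddChar (c * b) else 0) =
        1 / (Real.sqrt n : ℂ) *
        (if (k : ZMod n) * b = 0 then ZMod.stdAddChar ((c - r i) * b) else 0) := by
      intro b
      split_ifs
      · rw [mul_assoc, ← AddChar.map_add_eq_mul]
        congr 3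
        ring
      · simp
    rw [Finset.sum_congr rfl fun b _ => h' b, ← Finset.mul_sum, h, mul_zero, mul_zero]
  have hne : subgroupCharVec n k c ≠ 0 := by
    intro h
    have := congrArg (fun x : EuclideanSpace ℂ (ZMod n) => x 0) h
    simp [subgroupCharVec] at this
  have h := (hA _ hsp).1
  rw [hzero, norm_zero] at h
  have : 0 < (1 - δ) * ‖subgroupCharVec n k c‖ ^ 2 :=
    mul_pos (by linarith) (pow_pos (norm_pos_iff.2 hne) 2)
  norm_num at h
  linarith

/-- In particular there are at least `k` rows. -/
theorem RestrictedIsometry.le_rows {m n k : ℕ} [NeZero n] (hkn : k ∣ n) {δ : ℝ} (hδ : δ < 1)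
    {α : ℂ} {r : Fin m → ZMod n} (hA : RestrictedIsometry k δ (α • partialDFT r)) : k ≤ m := by
  have : NeZero k := ⟨fun h => NeZero.ne n (by simpa [h] using hkn)⟩
  have := Fintype.card_le_of_surjective (fun i => ZMod.castHom hkn (ZMod k) (r i))
    (hA.exists_row hkn hδ)
  simpa [ZMod.card] using this

/-! ### Residue classes of random rows, second moment -/

/-- Reduction mod `k` is a surjective homomorphism, so its fibres all have the same size and a
uniform row has a uniform residue. -/
theorem uniformOn_univ_castHom_notMem {n k : ℕ} [NeZero n] (hkn : k ∣ n) (T : Finset (ZMod k)) :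
    (uniformOn (Set.univ : Set (ZMod n))).real {a | ZMod.castHom hkn (ZMod k) a ∉ T} =
      1 - T.card / k := by
  have : NeZero k := ⟨fun h => NeZero.ne n (by simpa [h] using hkn)⟩
  have hk : (k : ℝ) ≠ 0 := by exact_mod_cast NeZero.ne k
  set π := ZMod.castHom hkn (ZMod k) with hπ
  have hfib (c : ZMod k) : (Finset.univ.filter fun a => π a = c).card =
      (Finset.univ.filter fun a => π a = 0).card :=
    AddMonoidHom.card_fiber_eq_of_mem_range π (ZMod.castHom_surjective hkn c)
      (ZMod.castHom_surjective hkn 0)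
  have hcount (U : Finset (ZMod k)) : (Finset.univ.filter fun a => π a ∈ U).card =
      U.card * (Finset.univ.filter fun a => π a = 0).card := by
    rw [Finset.card_eq_sum_card_fiberwise (f := π) (t := U) (fun a ha => by simpa using ha),
      Finset.sum_const_nat]
    intro c hc
    rw [← hfib c, Finset.filter_filter]
    congr 1
    ext a
    simp only [Finset.mem_filter, Finset.mem_univ, true_and]
    exact ⟨fun h => h.2, fun h => ⟨h ▸ hc, h⟩⟩
  set N := (Finset.univ.filter fun a => π a = 0).card with hNdef
  have hn : n = k * N := by
    have := hcount Finset.univ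
    simpa [ZMod.card] using this
  have hset : {a | π a ∉ T} = ((Finset.univ.filter fun a => π a ∈ Tᶜ : Finset (ZMod n)) : Set _) := by
    ext a; simp
  have hN : (N : ℝ) ≠ 0 := by
    intro h
    apply NeZero.ne n
    rw [hn, Nat.cast_eq_zero.1 h, mul_zero]
  have hn' : (n : ℝ) = k * N := by exact_mod_cast hn
  rw [measureReal_def, uniformOn_univ, hset, Measure.count_apply_finset, hcount, Finset.card_compl,
    ZMod.card, ZMod.card]
  rw [ENNReal.toReal_div, ENNReal.toReal_natCast, ENNReal.toReal_natCast, hn', Nat.cast_mul,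
    Nat.cast_sub (by simpa [ZMod.card] using T.card_le_univ)]
  field_simp

section Sampling

variable {m n k : ℕ} {Ω : Type*} [MeasurableSpace Ω] {μ : Measure Ω}
  {M : Fin m → Ω → ZMod n}

theorem measurableSet_avoid (hM : ∀ i, Measurable (M i)) (S : Set (ZMod n)) :
    MeasurableSet {ω | ∀ i, M i ω ∈ S} := by
  rw [Set.ofPred_forall]
  exact MeasurableSet.iInter fun i => hM i (MeasurableSet.of_discrete)

/-- The probability that independent uniform samples avoid `T.card` residue classes. -/
theorem measureReal_avoid [NeZero n] (hM : ∀ i, Measurable (M i)) (hind : iIndepFun M μ)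
    (hunif : ∀ i, μ.map (M i) = uniformOn (Set.univ : Set (ZMod n))) (hkn : k ∣ n)
    (T : Finset (ZMod k)) :
    μ.real {ω | ∀ i, M i ω ∈ {a | ZMod.castHom hkn (ZMod k) a ∉ T}} = (1 - T.card / k : ℝ) ^ m := by
  have h := hind.measure_inter_preimage_eq_mul Finset.univ
    (sets := fun _ => {a | ZMod.castHom hkn (ZMod k) a ∉ T}) fun _ _ => MeasurableSet.of_discrete
  have h1 : {ω | ∀ i, M i ω ∈ {a | ZMod.castHom hkn (ZMod k) a ∉ T}} =
      ⋂ i ∈ Finset.univ, M i ⁻¹' {a | ZMod.castHom hkn (ZMod k) a ∉ T} := by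
    ext ω; simp
  have h2 (i) : μ.real (M i ⁻¹' {a | ZMod.castHom hkn (ZMod k) a ∉ T}) = 1 - T.card / k := by
    rw [← map_measureReal_apply (hM i) MeasurableSet.of_discrete, hunif i,
      uniformOn_univ_castHom_notMem]
  rw [h1, measureReal_def, h, ENNReal.toReal_prod]
  simp only [← measureReal_def, h2, Finset.prod_const, Finset.card_univ, Fintype.card_fin]

end Sampling

/-- Second moment bound: the probability that none of finitely many equiprobable, pairwise
non-positively correlated events occurs. -/
theorem measureReal_none_mul_le_one {Ω ι : Type*} [Fintype ι] [MeasurableSpace Ω] {μ : Measure Ω}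
    [IsProbabilityMeasure μ] {E : ι → Set Ω} (hE : ∀ c, MeasurableSet (E c)) {p : ℝ}
    (hp : ∀ c, μ.real (E c) = p) (hpp : ∀ c c', c ≠ c' → μ.real (E c ∩ E c') ≤ p ^ 2) :
    μ.real {ω | ∀ c, ω ∉ E c} * (Fintype.card ι * p) ≤ 1 := by
  classical
  set N := {ω | ∀ c, ω ∉ E c} with hN
  set K : ℝ := (Fintype.card ι : ℝ) with hK
  rcases isEmpty_or_nonempty ι with hι | ⟨⟨c₀⟩⟩
  · simp [hK]
  have hp0 : 0 ≤ p := hp c₀ ▸ measureReal_nonneg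
  rcases hp0.eq_or_lt with h0 | hp0
  · simp [← h0]
  have hK0 : 0 < K := by
    have : Nonempty ι := ⟨c₀⟩
    exact Nat.cast_pos.2 Fintype.card_pos
  have hNm : MeasurableSet N := by
    rw [hN, Set.ofPred_forall]
    exact MeasurableSet.iInter fun c => (hE c).compl
  let I : Set Ω → Ω → ℝ := fun S => S.indicator 1
  have hI (S : Set Ω) (hS : MeasurableSet S) : Integrable (I S) μ :=
    (integrable_const (1 : ℝ)).indicator hS
  have hIint (S : Set Ω) (hS : MeasurableSet S) : ∫ ω, I S ω ∂μ = μ.real S :=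
    integral_indicator_one hS
  -- Chebyshev, pointwise: with `X` the number of events that occur, `(X - Kp)²` is nonnegative and
  -- equals `(Kp)²` where `X = 0`.
  have hpt (ω) : (K * p) ^ 2 * I N ω ≤ ∑ c, ∑ c', I (E c ∩ E c') ω -
      2 * (K * p) * ∑ c, I (E c) ω + (K * p) ^ 2 := by
    have hprod : ∑ c, ∑ c', I (E c ∩ E c') ω = (∑ c, I (E c) ω) ^ 2 := by
      rw [sq, Finset.sum_mul_sum]
      refine Finset.sum_congr rfl fun c _ => Finset.sum_congr rfl fun c' _ => ?_
      simp only [I]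
      rw [Set.inter_indicator_one, Pi.mul_apply]
    rw [hprod]
    by_cases hω : ω ∈ N
    · have : ∑ c, I (E c) ω = 0 :=
        Finset.sum_eq_zero fun c _ => Set.indicator_of_notMem (hω c) _
      rw [this]
      simp [I, hω]
    · have : I N ω = 0 := Set.indicator_of_notMem hω _
      rw [this]
      nlinarith [sq_nonneg (∑ c, I (E c) ω - K * p)]
  have hi1 : Integrable (fun ω => ∑ c, ∑ c', I (E c ∩ E c') ω) μ :=
    integrable_finsetSum _ fun c _ => integrable_finsetSum _ fun c' _ =>
      hI _ ((hE c).inter (hE c'))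
  have hi2 : Integrable (fun ω => ∑ c, I (E c) ω) μ :=
    integrable_finsetSum _ fun c _ => hI _ (hE c)
  have hint := integral_mono ((hI N hNm).const_mul ((K * p) ^ 2))
    ((hi1.sub (hi2.const_mul (2 * (K * p)))).add (integrable_const ((K * p) ^ 2))) hpt
  have hs1 : ∫ ω, ∑ c, I (E c) ω ∂μ = K * p := by
    rw [integral_finsetSum _ fun c _ => hI _ (hE c)]
    simp [hIint _ (hE _), hp, hK]
  have hs2 : ∫ ω, ∑ c, ∑ c', I (E c ∩ E c') ω ∂μ ≤ K * p + (K * p) ^ 2 := by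
    rw [integral_finsetSum _ fun c _ => integrable_finsetSum _ fun c' _ =>
      hI _ ((hE c).inter (hE c'))]
    have hc (c) : ∫ ω, ∑ c', I (E c ∩ E c') ω ∂μ ≤ p + K * p ^ 2 := by
      rw [integral_finsetSum _ fun c' _ => hI _ ((hE c).inter (hE c'))]
      calc ∑ c', ∫ ω, I (E c ∩ E c') ω ∂μ ≤ ∑ c', ((if c = c' then p else 0) + p ^ 2) := by
            refine Finset.sum_le_sum fun c' _ => ?_
            rw [hIint _ ((hE c).inter (hE c'))]
            split_ifs with h
            · rw [← h, Set.inter_self, hp]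
              exact le_add_of_nonneg_right (sq_nonneg p)
            · rw [zero_add]
              exact hpp c c' h
        _ = p + K * p ^ 2 := by
            rw [Finset.sum_add_distrib]
            simp [hK]
    calc _ ≤ ∑ _c : ι, (p + K * p ^ 2) := Finset.sum_le_sum fun c _ => hc c
      _ = K * p + (K * p) ^ 2 := by
        rw [Finset.sum_const, Finset.card_univ, nsmul_eq_mul]
        ring
  have hrhs : ∫ ω, (∑ c, ∑ c', I (E c ∩ E c') ω - 2 * (K * p) * ∑ c, I (E c) ω) + (K * p) ^ 2 ∂μ =
      ∫ ω, ∑ c, ∑ c', I (E c ∩ E c') ω ∂μ - 2 * (K * p) * (K * p) + (K * p) ^ 2 := by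
    have h1 := integral_add (hi1.sub (hi2.const_mul (2 * (K * p))))
      (integrable_const (μ := μ) ((K * p) ^ 2))
    have h2 := integral_sub hi1 (hi2.const_mul (2 * (K * p)))
    simp only [Pi.sub_apply, integral_const, probReal_univ, one_smul] at h1 h2
    rw [h1, h2, integral_const_mul, hs1]
  rw [integral_const_mul, hIint N hNm] at hint
  have hint2 := hint.trans hrhs.le
  have hKp : 0 < K * p := mul_pos hK0 hp0
  refine le_of_mul_le_mul_left ?_ hKp
  nlinarith

/-- Logarithmic form of `(1 - 1/k)^m ≥ exp (-2m/k)`. -/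
theorem neg_log_one_sub_inv_pow_le {k : ℕ} (m : ℕ) (hk : 2 ≤ k) :
    -Real.log ((1 - 1 / k : ℝ) ^ m) ≤ 2 * m / k := by
  have hk' : (2 : ℝ) ≤ k := by exact_mod_cast hk
  have hpos : (0 : ℝ) < 1 - 1 / k := by
    rw [sub_pos, div_lt_one (by linarith)]
    linarith
  have h := Real.one_sub_inv_le_log_of_pos hpos
  have h2 : (1 - 1 / k : ℝ)⁻¹ - 1 ≤ 2 / k := by
    have : (1 - 1 / k : ℝ)⁻¹ - 1 = 1 / (k - 1) := by
      have : (k : ℝ) - 1 ≠ 0 := by linarith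
      have : (k : ℝ) ≠ 0 := by linarith
      have : (1 - 1 / k : ℝ) ≠ 0 := hpos.ne'
      field_simp
      ring
    rw [this, div_le_div_iff₀ (by linarith) (by linarith)]
    linarith
  rw [Real.log_pow]
  have hm : (0 : ℝ) ≤ m := Nat.cast_nonneg _
  calc -(m * Real.log (1 - 1 / k)) = m * -Real.log (1 - 1 / k) := by ring
    _ ≤ m * (2 / k) := mul_le_mul_of_nonneg_left (by linarith) hm
    _ = 2 * m / k := by ring

/-! ### Assembling the bounds -/

theorem mainTheorem3 (δ : ℝ) (hδ : δ < 1 / 3) (η₀ : ℝ) (hη₀ : η₀ < 1) :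
    ∃ C : ℝ, 0 < C ∧
      ∀ (k m n : ℕ) [NeZero n], 2 ≤ k → k ∣ n →
      ∀ {Ω : Type*} [MeasurableSpace Ω] (μ : Measure Ω) [IsProbabilityMeasure μ]
        (M : Fin m → Ω → ZMod n),
        (∀ i, Measurable (M i)) →
        iIndepFun M μ →
        (∀ i, μ.map (M i) = uniformOn (Set.univ : Set (ZMod n))) →
      ∀ (α η : ℝ), 0 < η → η ≤ η₀ →
        1 - η ≤ μ.real {ω | RestrictedIsometry k δ ((α : ℂ) • partialDFT fun i => M i ω)} →
        C * k * (Real.log (Real.exp 1 * n) + Real.log (1 / (2 * η))) ≤ m := by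
  -- The bounds below cost `1` for `k`, `48 + 2B` for `k log n` and `2` for `k log (1/η)`; `55`
  -- leaves slack.
  refine ⟨1 / (55 + 2 * |Real.log (1 - η₀)|), by positivity, ?_⟩
  intro k m n _ hk hkn Ω _ μ _ M hM hind hunif α η hη hηη₀ hprob
  set B := |Real.log (1 - η₀)| with hB
  have hB0 : 0 ≤ B := abs_nonneg _
  have : NeZero k := ⟨by omega⟩
  have hk0 : (0 : ℝ) < k := by exact_mod_cast NeZero.pos k
  have hn0 : (0 : ℝ) < n := by exact_mod_cast NeZero.pos n
  set G := {ω | RestrictedIsometry k δ ((α : ℂ) • partialDFT fun i => M i ω)} with hG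
  let E : ZMod k → Set Ω := fun c =>
    {ω | ∀ i, M i ω ∈ {a | ZMod.castHom hkn (ZMod k) a ∉ ({c} : Finset (ZMod k))}}
  have hEm (c) : MeasurableSet (E c) := measurableSet_avoid hM _
  have hGE : G ⊆ {ω | ∀ c, ω ∉ E c} := by
    intro ω hω c hc
    obtain ⟨i, hi⟩ := RestrictedIsometry.exists_row hkn (by linarith) hω c
    exact hc i (Finset.mem_singleton.2 hi)
  set p : ℝ := (1 - 1 / k : ℝ) ^ m with hp
  have hEp (c) : μ.real (E c) = p := by
    have := measureReal_avoid hM hind hunif hkn {c}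
    rwa [Finset.card_singleton, Nat.cast_one] at this
  have hk2 : (2 : ℝ) ≤ k := by exact_mod_cast hk
  -- Negative correlation of two missed classes: `1 - 2/k ≤ (1 - 1/k)²`.
  have hpp (c c') (hc : c ≠ c') : μ.real (E c ∩ E c') ≤ p ^ 2 := by
    have h := measureReal_avoid hM hind hunif hkn {c, c'}
    rw [Finset.card_pair hc] at h
    have hset : E c ∩ E c' = {ω | ∀ i, M i ω ∈
        {a | ZMod.castHom hkn (ZMod k) a ∉ ({c, c'} : Finset (ZMod k))}} := by
      ext ω
      simp only [E, Set.mem_inter_iff, Set.mem_ofPred_eq, Finset.mem_insert, Finset.mem_singleton,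
        not_or, forall_and]
    rw [hset, h, hp, ← pow_mul, mul_comm m 2, pow_mul]
    refine pow_le_pow_left₀ ?_ ?_ m
    · rw [sub_nonneg, div_le_one hk0]
      exact_mod_cast hk
    · have : (1 - 1 / k : ℝ) ^ 2 = 1 - (2 : ℕ) / k + (1 / k) ^ 2 := by
        push_cast
        ring
      rw [this]
      exact le_add_of_nonneg_right (sq_nonneg _)
  have hp0 : 0 < p := by
    refine pow_pos ?_ m
    rw [sub_pos, div_lt_one hk0]
    linarith
  have hlogp : -Real.log p ≤ 2 * m / k := neg_log_one_sub_inv_pow_le m hk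
  rw [le_div_iff₀ hk0] at hlogp
  have hpη : p ≤ η := by
    have h1 : μ.real G ≤ μ.real (E 0)ᶜ := measureReal_mono fun ω hω => hGE hω 0
    rw [probReal_compl_eq_one_sub (hEm 0), hEp] at h1
    linarith
  have hlogη : k * -Real.log η ≤ 2 * m := by
    have := Real.log_le_log hp0 hpη
    nlinarith
  have hη₀' : 0 < 1 - η₀ := by linarith
  have hlogk : k * Real.log k ≤ 2 * m + B * k := by
    have h1 := measureReal_none_mul_le_one hEm hEp hpp
    rw [ZMod.card] at h1
    have h2 : (1 - η₀) * (k * p) ≤ 1 := by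
      refine le_trans (mul_le_mul_of_nonneg_right ?_ (by positivity)) h1
      have : μ.real G ≤ μ.real {ω | ∀ c, ω ∉ E c} := measureReal_mono hGE
      linarith
    have h3 := Real.log_le_log (by positivity) h2
    rw [Real.log_mul hη₀'.ne' (by positivity), Real.log_mul hk0.ne' hp0.ne', Real.log_one] at h3
    have h4 : -Real.log (1 - η₀) ≤ B := neg_le_abs _
    nlinarith
  -- Since `η < 1`, some sample is good; the deterministic bounds apply to it.
  obtain ⟨ω, hω⟩ : G.Nonempty := by
    by_contra h
    rw [Set.not_nonempty_iff_eq_empty.1 h, measureReal_empty] at hprob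
    linarith
  have hω : RestrictedIsometry k δ ((α : ℂ) • partialDFT fun i => M i ω) := hω
  have hkm : (k : ℝ) ≤ m := by exact_mod_cast hω.le_rows hkn (by linarith)
  have hlogn : k * Real.log n ≤ 48 * m + 2 * B * m := by
    rcases le_or_gt (k ^ 2) n with h | h
    · have := hω.mul_log_le_of_sq_le (ZMod.card n) hδ hk h
      nlinarith
    · have h1 : Real.log n ≤ 2 * Real.log k := by
        rw [← Nat.cast_two, ← Real.log_pow]
        exact Real.log_le_log hn0 (by exact_mod_cast h.le)
      nlinarith
  have hlog : Real.log (Real.exp 1 * n) + Real.log (1 / (2 * η)) ≤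
      1 + Real.log n + -Real.log η := by
    rw [Real.log_mul (Real.exp_ne_zero 1) hn0.ne', Real.log_exp, one_div, Real.log_inv,
      Real.log_mul two_ne_zero hη.ne']
    have := Real.log_nonneg one_le_two
    linarith
  rw [mul_assoc, one_div, inv_mul_le_iff₀ (by positivity)]
  calc (k : ℝ) * (Real.log (Real.exp 1 * n) + Real.log (1 / (2 * η)))
      ≤ k * (1 + Real.log n + -Real.log η) := mul_le_mul_of_nonneg_left hlog hk0.le
    _ = k + k * Real.log n + k * -Real.log η := by ring
    _ ≤ (55 + 2 * B) * m := by nlinarith
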